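/- Consider black-box functions $f:\{0,1\}^n\to\{0,1\}$. A $\mathsf{QMA}^f(k)$ protocol with $T$ queries consists of witness lengths $q_1,\dots,q_k\ge 0$, a number $s$ of workspace qubits, unitaries $U_0,\dots,U_T$ (not depending on $f$) acting on an $n$-qubit query register, a one-qubit answer register, the $s$ workspace qubits and the $k$ witness registers of $q_1,\dots,q_k$ qubits, and a set of accepting computational basis states. Given pure states $|\psi_i\rangle$ of $q_i$ qubits ($1\le i\le k$), sent by $k$ unentangled Merlins, Arthur prepares $|0^n\rangle|0\rangle|0^s\rangle\otimes|\psi_1\rangle\otimes\cdots\otimes|\psi_k\rangle$, applies $U_T\,O_f\,U_{T-1}\cdots O_f\,U_0$, where $O_f|x\rangle|c\rangle=|x\rangle|c\oplus f(x)\rangle$, measures in the computational basis, and accepts if and only if the outcome is in the accepting set. The protocol certifies the existence of an $x$ with $f(x)=1$, with error bounds $a,b\in\mathbb{R}$, if for every $f:\{0,1\}^n\to\{0,1\}$: (i) if $f(x)=1$ for some $x$, then there are unit vectors $|\psi_1\rangle,\dots,|\psi_k\rangle$ on which Arthur accepts with probability at least $b$; (ii) if $f$ is identically zero, then Arthur accepts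 with probability at most $a$ on all unit vectors $|\psi_1\rangle,\dots,|\psi_k\rangle$. **Theorem.** Any such protocol with polynomially many queries (in particular, any such protocol in which Arthur runs in polynomial time) and with gap $b-a=\Omega(1/\mathrm{poly}(n))$ must involve $n-O(\log n)$ qubits sent by the Merlins in total. Precisely: for all $A,\delta\in\mathbb{R}$ with $\delta>0$ and all integers $c,d\ge 0$ there is a constant $C$, depending only on $A,\delta,c,d$, such that for every $n\ge 2$, every $k\ge 0$ and all $a,b\in\mathbb{R}$, every $\mathsf{QMA}^f(k)$ protocol with $T\le A\,n^c$ queries which certifies the existence of an $x\in\{0,1\}^n$ with $f(x)=1$, with error bounds $a,b$ satisfying $b-a\ge\delta/n^d$, has $$q_1+\cdots+q_k\;\ge\;n-C\log_2 n .$$ -/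

import Mathlib

open scoped Matrix

/-- Computational basis states of an `m`-qubit register. -/
abbrev Bits (m : ℕ) : Type := Fin m → Bool

/-- Computational basis states of all the registers that Arthur acts on: the `n`-qubit query
register, the one-qubit answer register, a workspace of `s` qubits, and the `k` witness registers,
the `i`-th of which holds the `q i` qubits sent by the `i`-th Merlin. -/
abbrev RegBasis (n s : ℕ) {k : ℕ} (q : Fin k → ℕ) : Type :=
  Bits n × Bool × Bits s × ((i : Fin k) → Bits (q i))

instance {n s k : ℕ} {q : Fin k → ℕ} : DecidableEq (RegBasis n s q) :=
  letI : DecidableEq (Bits s × ((i : Fin k) → Bits (q i))) := inferInstance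
  letI : DecidableEq (Bool × Bits s × ((i : Fin k) → Bits (q i))) := instDecidableEqProd
  instDecidableEqProd

/-- The standard quantum black box for `f`, the unitary map
`|x⟩|c⟩|w⟩|z⟩ ↦ |x⟩|c ⊕ f x⟩|w⟩|z⟩`, acting on a vector of amplitudes.
(It is an involution on basis states, so the amplitude of the image at a basis state `e` is the
amplitude of the original vector at the image of `e`.) -/
def applyOracle {n s k : ℕ} {q : Fin k → ℕ} (f : Bits n → Bool)
    (v : RegBasis n s q → ℂ) : RegBasis n s q → ℂ :=
  fun e => v (e.1, xor e.2.1 (f e.1), e.2.2)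

/-- A `QMA^f(k)` verification procedure with black-box access to some `f : {0,1}^n → {0,1}`.
Between the queries Arthur may apply arbitrary unitaries, which do not depend on `f`, to all of
his qubits. At the end he measures all of his qubits in the computational basis. -/
structure QMAProtocol (n k : ℕ) where
  /-- The number of qubits sent by each Merlin. -/
  witnessQubits : Fin k → ℕ
  /-- The number of workspace qubits, besides the query and answer registers. -/
  workQubits : ℕ
  /-- The number `T` of queries made to the black box. -/
  queries : ℕ
  /-- Arthur's unitaries: `U 0` is applied before the first query and `U t` right after the `t`-th
  query. Only `U 0, …, U T` are ever used. -/
  U : ℕ → Matrix.unitaryGroup (RegBasis n workQubits witnessQubits) ℂ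
  /-- The final measurement outcomes on which Arthur accepts. -/
  accept : Set (RegBasis n workQubits witnessQubits)

namespace QMAProtocol

variable {n k : ℕ}

/-- The total number of qubits sent by the Merlins. -/
def totalWitnessQubits (P : QMAProtocol n k) : ℕ := ∑ i, P.witnessQubits i

/-- A `k`-tuple of vectors, one for each witness register. -/
abbrev Witnesses (P : QMAProtocol n k) : Type :=
  (i : Fin k) → EuclideanSpace ℂ (Bits (P.witnessQubits i))

/-- The initial state `|0^n⟩|0⟩|0^s⟩ ⊗ |ψ₁⟩ ⊗ ⋯ ⊗ |ψ_k⟩`. -/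
def initialState (P : QMAProtocol n k) (ψ : P.Witnesses) :
    RegBasis n P.workQubits P.witnessQubits → ℂ :=
  fun e => if e.1 = (fun _ => false) ∧ e.2.1 = false ∧ e.2.2.1 = (fun _ => false)
    then ∏ i, ψ i (e.2.2.2 i) else 0

/-- Arthur's state after `t` queries to `f`, each followed by the corresponding unitary:
`U t · O_f · U (t-1) ⋯ O_f · U 0` applied to the initial state. -/
def stateAfter (P : QMAProtocol n k) (f : Bits n → Bool) (ψ : P.Witnesses) :
    ℕ → (RegBasis n P.workQubits P.witnessQubits → ℂ)
  | 0 => (P.U 0 : Matrix _ _ ℂ) *ᵥ P.initialState ψ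
  | t + 1 => (P.U (t + 1) : Matrix _ _ ℂ) *ᵥ applyOracle f (P.stateAfter f ψ t)

open Classical in
/-- The probability that Arthur accepts the witnesses `|ψ₁⟩, …, |ψ_k⟩` when the black box
is `f`. -/
noncomputable def acceptProb (P : QMAProtocol n k) (f : Bits n → Bool) (ψ : P.Witnesses) : ℝ :=
  ∑ e, if e ∈ P.accept then ‖P.stateAfter f ψ P.queries e‖ ^ 2 else 0

/-- `P` certifies the existence of an `x` with `f x = 1`, with error bounds `a` and `b`: for every
black box `f` that has such an `x`, some unentangled witnesses are accepted with probability at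
least `b`, and for every `f` that has none, all unentangled witnesses are accepted with probability
at most `a`. -/
def CertifiesExistence (P : QMAProtocol n k) (a b : ℝ) : Prop :=
  ∀ f : Bits n → Bool,
    ((∃ x, f x = true) → ∃ ψ : P.Witnesses, (∀ i, ‖ψ i‖ = 1) ∧ b ≤ P.acceptProb f ψ) ∧
    ((¬ ∃ x, f x = true) → ∀ ψ : P.Witnesses, (∀ i, ‖ψ i‖ = 1) → P.acceptProb f ψ ≤ a)

end QMAProtocol

/-! Compare the zero function with the `2 ^ n` point functions. By the hybrid argument, a witness `ψ
x` that works for the point `x` must, when run on the zero function, put substantial query amplitude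
on `x` (`acceptProb_sub_le`). On the zero function the run is a fixed unitary applied to the
witness, so by Cauchy–Schwarz the query weight at `x` is at most its sum over all basis witnesses,
whatever `ψ x` is. Summed over `x`, this is at most the dimension `2 ^ q` of the witness space, with
`q` the total witness length (`sum_queryAmplitude_sq_le`). Hence `2 ^ n * ε ^ 2 ≤ 16 * T ^ 2 * 2 ^
q` for `T` queries and gap at least `ε ≥ 0`; logarithms finish. Of the product form of the witness,
only its unit norm matters. -/

/-- The Euclidean norm of a vector of amplitudes. -/
noncomputable def amplitudeNorm {ι : Type*} [Fintype ι] (v : ι → ℂ) : ℝ :=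
  ‖(WithLp.toLp 2 v : EuclideanSpace ℂ ι)‖

section AmplitudeNorm

variable {ι : Type*} [Fintype ι]

theorem amplitudeNorm_nonneg (v : ι → ℂ) : 0 ≤ amplitudeNorm v := norm_nonneg _

theorem amplitudeNorm_sq (v : ι → ℂ) : amplitudeNorm v ^ 2 = ∑ e, ‖v e‖ ^ 2 := by
  simp [amplitudeNorm, EuclideanSpace.norm_sq_eq]

theorem amplitudeNorm_add_le (v w : ι → ℂ) :
    amplitudeNorm (v + w) ≤ amplitudeNorm v + amplitudeNorm w := by
  simpa [amplitudeNorm] using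
    norm_add_le (WithLp.toLp 2 v : EuclideanSpace ℂ ι) (WithLp.toLp 2 w)

theorem amplitudeNorm_sub_le (v w : ι → ℂ) :
    amplitudeNorm (v - w) ≤ amplitudeNorm v + amplitudeNorm w := by
  simpa [amplitudeNorm] using
    norm_sub_le (WithLp.toLp 2 v : EuclideanSpace ℂ ι) (WithLp.toLp 2 w)

theorem amplitudeNorm_sub_amplitudeNorm_le (v w : ι → ℂ) :
    amplitudeNorm v - amplitudeNorm w ≤ amplitudeNorm (v - w) := by
  have h := amplitudeNorm_add_le (v - w) w
  rw [sub_add_cancel] at h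
  linarith

theorem amplitudeNorm_unitary_mulVec [DecidableEq ι] (U : Matrix.unitaryGroup ι ℂ) (v : ι → ℂ) :
    amplitudeNorm ((U : Matrix ι ι ℂ) *ᵥ v) = amplitudeNorm v := by
  have key (w : ι → ℂ) : ((amplitudeNorm w ^ 2 : ℝ) : ℂ) = star w ⬝ᵥ w := by
    rw [amplitudeNorm_sq]
    push_cast
    refine Finset.sum_congr rfl fun e _ => ?_
    simpa using (Complex.conj_mul' (w e)).symm
  have h : amplitudeNorm ((U : Matrix ι ι ℂ) *ᵥ v) ^ 2 = amplitudeNorm v ^ 2 := by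
    apply Complex.ofReal_injective
    rw [key, key, Matrix.star_mulVec, Matrix.dotProduct_mulVec, Matrix.vecMul_vecMul,
      ← Matrix.star_eq_conjTranspose, Unitary.coe_star_mul_self, Matrix.vecMul_one]
  exact (sq_eq_sq₀ (amplitudeNorm_nonneg _) (amplitudeNorm_nonneg _)).1 h

theorem sum_norm_sq_unitary_column [DecidableEq ι] (U : Matrix.unitaryGroup ι ℂ) (j : ι) :
    ∑ e, ‖(U : Matrix ι ι ℂ) e j‖ ^ 2 = 1 := by
  have h := congrArg (· ^ 2) (amplitudeNorm_unitary_mulVec U (Pi.single j 1))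
  simp only [amplitudeNorm_sq] at h
  simpa [Pi.single_apply, apply_ite] using h

theorem amplitudeNorm_indicator_le (S : Set ι) (v : ι → ℂ) :
    amplitudeNorm (S.indicator v) ≤ amplitudeNorm v := by
  refine (sq_le_sq₀ (amplitudeNorm_nonneg _) (amplitudeNorm_nonneg _)).1 ?_
  rw [amplitudeNorm_sq, amplitudeNorm_sq]
  gcongr
  exact norm_indicator_le_norm_self _ _

theorem amplitudeNorm_indicator_sq_sub_le (S : Set ι) {v w : ι → ℂ}
    (hv : amplitudeNorm v ≤ 1) (hw : amplitudeNorm w ≤ 1) :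
    amplitudeNorm (S.indicator v) ^ 2 - amplitudeNorm (S.indicator w) ^ 2
      ≤ 2 * amplitudeNorm (v - w) := by
  have h1 := (amplitudeNorm_indicator_le S v).trans hv
  have h2 := (amplitudeNorm_indicator_le S w).trans hw
  have h3 := amplitudeNorm_sub_amplitudeNorm_le (S.indicator v) (S.indicator w)
  rw [← Set.indicator_sub'] at h3
  have h4 := h3.trans (amplitudeNorm_indicator_le S (v - w))
  have h5 := amplitudeNorm_nonneg (S.indicator v)
  have h6 := amplitudeNorm_nonneg (S.indicator w)
  have h7 := amplitudeNorm_nonneg (v - w)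
  calc _ = (amplitudeNorm (S.indicator v) + amplitudeNorm (S.indicator w))
        * (amplitudeNorm (S.indicator v) - amplitudeNorm (S.indicator w)) := by ring
    _ ≤ (amplitudeNorm (S.indicator v) + amplitudeNorm (S.indicator w))
        * amplitudeNorm (v - w) := by gcongr
    _ ≤ _ := by gcongr; linarith

end AmplitudeNorm

/-! ### Oracle calls -/

section Oracle

variable {n s k : ℕ} {q : Fin k → ℕ}

theorem applyOracle_sub (f : Bits n → Bool) (v w : RegBasis n s q → ℂ) :
    applyOracle f (v - w) = applyOracle f v - applyOracle f w := rfl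

theorem applyOracle_false (v : RegBasis n s q → ℂ) :
    applyOracle (fun _ => false) v = v := by
  funext e
  simp [applyOracle]

theorem amplitudeNorm_applyOracle (f : Bits n → Bool) (v : RegBasis n s q → ℂ) :
    amplitudeNorm (applyOracle f v) = amplitudeNorm v := by
  have h : amplitudeNorm (applyOracle f v) ^ 2 = amplitudeNorm v ^ 2 := by
    rw [amplitudeNorm_sq, amplitudeNorm_sq]
    let σ : RegBasis n s q → RegBasis n s q := fun e => (e.1, xor e.2.1 (f e.1), e.2.2)
    have hσ : Function.Involutive σ := fun e => by simp [σ]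
    exact Equiv.sum_comp hσ.toPerm fun e => ‖v e‖ ^ 2
  exact (sq_eq_sq₀ (amplitudeNorm_nonneg _) (amplitudeNorm_nonneg _)).1 h

/-- The oracle of the indicator function of `x` moves a state by at most twice its query amplitude
at `x`. -/
theorem amplitudeNorm_applyOracle_sub_le (x : Bits n) (v : RegBasis n s q → ℂ) :
    amplitudeNorm (applyOracle (fun y => decide (y = x)) v - v)
      ≤ 2 * amplitudeNorm ({e : RegBasis n s q | e.1 = x}.indicator v) := by
  -- The oracle fixes every basis state that does not query `x`, so only this part of `v`
  -- contributes.
  set w := {e : RegBasis n s q | e.1 = x}.indicator v with hw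
  have h : applyOracle (fun y => decide (y = x)) v - v
      = applyOracle (fun y => decide (y = x)) w - w := by
    funext e
    by_cases he : e.1 = x <;> simp [hw, applyOracle, he]
  rw [h]
  have := amplitudeNorm_sub_le (applyOracle (fun y => decide (y = x)) w) w
  rw [amplitudeNorm_applyOracle] at this
  linarith

end Oracle

/-! ### Query weights and the hybrid bound -/

namespace QMAProtocol

variable {n k : ℕ} (P : QMAProtocol n k)

/-- Arthur's basis state in which every register except the witness registers is zero. -/
def witnessState (z : (i : Fin k) → Bits (P.witnessQubits i)) :
    RegBasis n P.workQubits P.witnessQubits :=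
  (fun _ => false, false, fun _ => false, z)

/-- The product `U t ⋯ U 0` of Arthur's unitaries. -/
def unitaryProd : ℕ → Matrix.unitaryGroup (RegBasis n P.workQubits P.witnessQubits) ℂ
  | 0 => P.U 0
  | t + 1 => P.U (t + 1) * unitaryProd t

theorem stateAfter_false (ψ : P.Witnesses) (t : ℕ) :
    P.stateAfter (fun _ => false) ψ t
      = (P.unitaryProd t : Matrix _ _ ℂ) *ᵥ P.initialState ψ := by
  induction t with
  | zero => rfl
  | succ t ih =>
    rw [stateAfter, applyOracle_false, ih, Matrix.mulVec_mulVec]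
    rfl

/-- A general `g` serves both the norm of the initial state and the entries of a matrix applied to
it. -/
theorem sum_initialState_mul (ψ : P.Witnesses)
    (g : RegBasis n P.workQubits P.witnessQubits → ℂ → ℂ) (hg : ∀ e, g e 0 = 0) :
    ∑ e, g e (P.initialState ψ e)
      = ∑ z, g (P.witnessState z) (∏ i, ψ i (z i)) := by
  symm
  have hinj : Function.Injective P.witnessState := fun z z' h => by
    simpa [witnessState] using h
  refine Finset.sum_of_injOn P.witnessState hinj.injOn (by simp) ?_ ?_
  · rintro ⟨x, c, w, z⟩ - h
    have : ¬ (x = (fun _ => false) ∧ c = false ∧ w = (fun _ => false)) := by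
      rintro ⟨rfl, rfl, rfl⟩
      exact h ⟨z, by simp, rfl⟩
    simp [initialState, this, hg]
  · intro z _
    simp [initialState, witnessState]

theorem sum_norm_sq_witness (ψ : P.Witnesses) (hψ : ∀ i, ‖ψ i‖ = 1) :
    ∑ z : (i : Fin k) → Bits (P.witnessQubits i), ‖∏ i, ψ i (z i)‖ ^ 2 = 1 := by
  have h (i : Fin k) : ∑ y, ‖ψ i y‖ ^ 2 = 1 := by
    rw [← EuclideanSpace.norm_sq_eq, hψ i, one_pow]
  simp_rw [norm_prod, ← Finset.prod_pow]
  rw [← Fintype.piFinset_univ, ← Finset.prod_univ_sum (fun _ => Finset.univ) fun i y => ‖ψ i y‖ ^ 2]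
  simp [h]

theorem amplitudeNorm_initialState (ψ : P.Witnesses) (hψ : ∀ i, ‖ψ i‖ = 1) :
    amplitudeNorm (P.initialState ψ) = 1 := by
  have h : amplitudeNorm (P.initialState ψ) ^ 2 = 1 := by
    rw [amplitudeNorm_sq, ← P.sum_norm_sq_witness ψ hψ]
    apply Complex.ofReal_injective
    push_cast
    simpa using P.sum_initialState_mul ψ (fun _ c => (‖c‖ : ℂ) ^ 2) (by simp)
  exact (pow_eq_one_iff_of_nonneg (amplitudeNorm_nonneg _) two_ne_zero).1 h

theorem amplitudeNorm_stateAfter (f : Bits n → Bool) (ψ : P.Witnesses) (hψ : ∀ i, ‖ψ i‖ = 1)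
    (t : ℕ) : amplitudeNorm (P.stateAfter f ψ t) = 1 := by
  induction t with
  | zero => rw [stateAfter, amplitudeNorm_unitary_mulVec, P.amplitudeNorm_initialState ψ hψ]
  | succ t ih => rw [stateAfter, amplitudeNorm_unitary_mulVec, amplitudeNorm_applyOracle, ih]

theorem acceptProb_eq (f : Bits n → Bool) (ψ : P.Witnesses) :
    P.acceptProb f ψ = amplitudeNorm (P.accept.indicator (P.stateAfter f ψ P.queries)) ^ 2 := by
  classical
  rw [amplitudeNorm_sq, acceptProb]
  refine Finset.sum_congr rfl fun e _ => ?_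
  by_cases he : e ∈ P.accept <;> simp [he]

/-- The amplitude with which the query after `t` steps asks for `x`, when the black box is
identically zero. -/
noncomputable def queryAmplitude (ψ : P.Witnesses) (x : Bits n) (t : ℕ) : ℝ :=
  amplitudeNorm ({e | e.1 = x}.indicator (P.stateAfter (fun _ => false) ψ t))

/-- The hybrid argument. -/
theorem amplitudeNorm_stateAfter_sub_le (ψ : P.Witnesses) (x : Bits n) (t : ℕ) :
    amplitudeNorm (P.stateAfter (fun y => decide (y = x)) ψ t
        - P.stateAfter (fun _ => false) ψ t)
      ≤ ∑ r ∈ Finset.range t, 2 * P.queryAmplitude ψ x r := by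
  induction t with
  | zero => simp [stateAfter, amplitudeNorm]
  | succ t ih =>
    rw [Finset.sum_range_succ, stateAfter, stateAfter, ← Matrix.mulVec_sub,
      amplitudeNorm_unitary_mulVec, applyOracle_false]
    set v := P.stateAfter (fun y => decide (y = x)) ψ t
    set w := P.stateAfter (fun _ => false) ψ t with hw
    -- Splitting this way charges the new error to `w`, the run on the zero function; the old error
    -- is preserved by unitarity.
    have h := amplitudeNorm_add_le (applyOracle (fun y => decide (y = x)) (v - w))
      (applyOracle (fun y => decide (y = x)) w - w)
    rw [amplitudeNorm_applyOracle, applyOracle_sub, sub_add_sub_cancel] at h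
    have h' := amplitudeNorm_applyOracle_sub_le x w
    rw [queryAmplitude, ← hw]
    linarith

theorem acceptProb_sub_le (ψ : P.Witnesses) (hψ : ∀ i, ‖ψ i‖ = 1) (x : Bits n) :
    P.acceptProb (fun y => decide (y = x)) ψ - P.acceptProb (fun _ => false) ψ
      ≤ 4 * ∑ t ∈ Finset.range P.queries, P.queryAmplitude ψ x t := by
  rw [acceptProb_eq, acceptProb_eq]
  have h := amplitudeNorm_indicator_sq_sub_le P.accept
    (P.amplitudeNorm_stateAfter (fun y => decide (y = x)) ψ hψ P.queries).le
    (P.amplitudeNorm_stateAfter (fun _ => false) ψ hψ P.queries).le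
  have h' := P.amplitudeNorm_stateAfter_sub_le ψ x P.queries
  rw [← Finset.mul_sum] at h'
  linarith

/-- The query weight of a product witness is at most the total query weight of all the basis
witnesses. -/
theorem queryAmplitude_sq_le (ψ : P.Witnesses) (hψ : ∀ i, ‖ψ i‖ = 1) (x : Bits n) (t : ℕ) :
    P.queryAmplitude ψ x t ^ 2
      ≤ ∑ e : RegBasis n P.workQubits P.witnessQubits, if e.1 = x then
          ∑ z, ‖(P.unitaryProd t : Matrix _ _ ℂ) e (P.witnessState z)‖ ^ 2 else 0 := by
  rw [queryAmplitude, amplitudeNorm_sq]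
  refine Finset.sum_le_sum fun e _ => ?_
  by_cases he : e.1 = x
  · rw [Set.indicator_of_mem (by exact he), if_pos he, stateAfter_false, Matrix.mulVec, dotProduct,
      P.sum_initialState_mul ψ (fun e' c => (P.unitaryProd t : Matrix _ _ ℂ) e e' * c) (by simp)]
    calc _ ≤ (∑ z, ‖(P.unitaryProd t : Matrix _ _ ℂ) e (P.witnessState z)‖
            * ‖∏ i, ψ i (z i)‖) ^ 2 := by
          gcongr
          exact (norm_sum_le _ _).trans_eq (by simp only [norm_mul])
      -- Cauchy–Schwarz over the basis witnesses `z`.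
      _ ≤ _ := Finset.sum_mul_sq_le_sq_mul_sq _ _ _
      _ = _ := by rw [P.sum_norm_sq_witness ψ hψ, mul_one]
  · rw [Set.indicator_of_notMem (by exact he), if_neg he]
    simp

/-- The bound of `queryAmplitude_sq_le` does not involve the witness, so each `x` may have its own.
Summing over `x` completes full columns of a unitary matrix, each of norm one, with one column per
basis witness. -/
theorem sum_queryAmplitude_sq_le (ψ : Bits n → P.Witnesses) (hψ : ∀ x i, ‖ψ x i‖ = 1) (t : ℕ) :
    ∑ x, P.queryAmplitude (ψ x) x t ^ 2 ≤ 2 ^ P.totalWitnessQubits := by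
  refine (Finset.sum_le_sum fun x _ => P.queryAmplitude_sq_le (ψ x) (hψ x) x t).trans_eq ?_
  rw [Finset.sum_comm]
  simp only [Finset.sum_ite_eq, Finset.mem_univ, if_true]
  rw [Finset.sum_comm]
  simp only [sum_norm_sq_unitary_column]
  simp [totalWitnessQubits, Finset.prod_pow_eq_pow_sum]

theorem CertifiesExistence.two_pow_mul_sq_le {P : QMAProtocol n k} {a b ε : ℝ}
    (h : P.CertifiesExistence a b) (hε : 0 ≤ ε) (hab : ε ≤ b - a) :
    2 ^ n * ε ^ 2 ≤ 16 * (P.queries : ℝ) ^ 2 * 2 ^ P.totalWitnessQubits := by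
  choose ψ hψ hb using fun x : Bits n => (h fun y => decide (y = x)).1 ⟨x, by simp⟩
  have key (x : Bits n) :
      ε ^ 2 ≤ 16 * (P.queries * ∑ t ∈ Finset.range P.queries,
        P.queryAmplitude (ψ x) x t ^ 2) := by
    have ha := (h fun _ => false).2 (by simp) (ψ x) (hψ x)
    have h1 := P.acceptProb_sub_le (ψ x) (hψ x) x
    have h2 : ε ≤ 4 * ∑ t ∈ Finset.range P.queries, P.queryAmplitude (ψ x) x t := by
      linarith [hb x]
    have h3 := sq_sum_le_card_mul_sum_sq (s := Finset.range P.queries)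
      (f := fun t => P.queryAmplitude (ψ x) x t)
    rw [Finset.card_range] at h3
    calc ε ^ 2 ≤ (4 * ∑ t ∈ Finset.range P.queries, P.queryAmplitude (ψ x) x t) ^ 2 := by gcongr
      _ = 16 * (∑ t ∈ Finset.range P.queries, P.queryAmplitude (ψ x) x t) ^ 2 := by ring
      _ ≤ _ := by gcongr
  calc 2 ^ n * ε ^ 2 = ∑ _x : Bits n, ε ^ 2 := by simp
    _ ≤ ∑ x, 16 * (P.queries * ∑ t ∈ Finset.range P.queries,
        P.queryAmplitude (ψ x) x t ^ 2) := Finset.sum_le_sum fun x _ => key x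
    _ = 16 * (P.queries * ∑ t ∈ Finset.range P.queries,
        ∑ x, P.queryAmplitude (ψ x) x t ^ 2) := by
      rw [Finset.sum_comm, Finset.mul_sum, Finset.mul_sum]
    _ ≤ 16 * (P.queries * ∑ t ∈ Finset.range P.queries, 2 ^ P.totalWitnessQubits) := by
      gcongr with t
      exact P.sum_queryAmplitude_sq_le ψ hψ t
    _ = _ := by
      rw [Finset.sum_const, Finset.card_range, nsmul_eq_mul]
      ring

end QMAProtocol

/-! ### Taking logarithms -/

theorem mainTheorem10 (A δ : ℝ) (c d : ℕ) (hδ : 0 < δ) :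
    ∃ C : ℝ, ∀ n : ℕ, 2 ≤ n → ∀ (k : ℕ) (P : QMAProtocol n k) (a b : ℝ),
      (P.queries : ℝ) ≤ A * (n : ℝ) ^ c →
      δ / (n : ℝ) ^ d ≤ b - a →
      P.CertifiesExistence a b →
      (n : ℝ) - C * Real.logb 2 (n : ℝ) ≤ (P.totalWitnessQubits : ℝ) := by
  -- `B * n ^ (c + d)` bounds `4 * T / ε` at `ε = δ / n ^ d`; `max A 1` keeps `B` positive when `A ≤
  -- 0`.
  set B := 4 * max A 1 / δ with hB
  have hB0 : 0 < B := by positivity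
  refine ⟨2 * (|Real.logb 2 B| + (c + d : ℕ)), fun n hn k P a b hT hab h => ?_⟩
  have hn0 : (0 : ℝ) < n := by positivity
  have hlog : 1 ≤ Real.logb 2 (n : ℝ) := by
    rw [Real.le_logb_iff_rpow_le one_lt_two hn0]
    simpa using (by exact_mod_cast hn : (2 : ℝ) ≤ n)
  have hT' : (P.queries : ℝ) ≤ max A 1 * (n : ℝ) ^ c :=
    hT.trans (by gcongr; exact le_max_left _ _)
  have hmain := h.two_pow_mul_sq_le (by positivity) hab
  have hbound : (2 : ℝ) ^ n ≤ (B * (n : ℝ) ^ (c + d)) ^ 2 * 2 ^ P.totalWitnessQubits := by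
    refine le_of_mul_le_mul_right ?_ (by positivity : 0 < (δ / (n : ℝ) ^ d) ^ 2)
    calc _ ≤ 16 * (P.queries : ℝ) ^ 2 * 2 ^ P.totalWitnessQubits := hmain
      _ ≤ 16 * (max A 1 * (n : ℝ) ^ c) ^ 2 * 2 ^ P.totalWitnessQubits := by gcongr
      _ = _ := by
        rw [hB, pow_add]
        field_simp
        ring
  have hl := Real.logb_le_logb_of_le one_lt_two (by positivity) hbound
  rw [Real.logb_mul (by positivity) (by positivity), Real.logb_pow, Real.logb_pow, Real.logb_pow,
    Real.logb_mul (by positivity) (by positivity), Real.logb_pow,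
    Real.logb_self_eq_one one_lt_two] at hl
  -- Since `n ≥ 2`, the constant term is absorbed into the multiple of `log n`.
  have h1 : Real.logb 2 B ≤ |Real.logb 2 B| * Real.logb 2 n :=
    (le_abs_self _).trans (le_mul_of_one_le_right (abs_nonneg _) hlog)
  push_cast at hl ⊢
  linarith
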